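/- All groups are finite. For a group $G$ let $c(G)$ be the number of cyclic subgroups of $G$ and let $\alpha(G) = c(G)/|G|$. Let $C_2$ be the group of order $2$, $S_3$ the symmetric group on three letters and $D_8$ the dihedral group of order $8$. Then $\alpha(S_3)=5/6$, $\alpha(D_8)=7/8$, and for every $n \geq 0$ one has $\alpha(C_2^n \times S_3) = 5/6$, $\alpha(C_2^n \times D_8) = 7/8$ and $\alpha(C_2^n)=1$. If $\alpha(G) \geq 5/6$, then one of the following holds: (1) $G \cong C_2^n \times S_3$ for some $n \geq 0$, and $\alpha(G)=5/6$; (2) $G \cong C_2^n \times D_8$ for some $n \geq 0$, and $\alpha(G)=7/8$; (3) $G \cong C_2^n$ for some $n \geq 0$, and $\alpha(G)=1$. Consequently, the maximum of $\alpha$ over the family of non-abelian groups is $7/8$, and the non-abelian groups attaining it are exactly the groups isomorphic to $C_2^n \times D_8$ for some $n \geq 0$; and the maximum of $\alpha$ over the family of non-nilpotent groups is $5/6$, and the non-nilpotent groups attaining it are exactly the groups isomorphic to $C_2^n \times S_3$ for some $n \geq 0$. -/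

import Mathlib

universe u

/-- The number `c(G)` of cyclic subgroups of `G`. -/
noncomputable def numCyclicSubgroups (G : Type*) [Group G] : ℕ :=
  Set.ncard {H : Subgroup G | IsCyclic H}

/-- `α(G) = c(G) / |G|`. -/
noncomputable def alpha (G : Type*) [Group G] : ℚ :=
  (numCyclicSubgroups G : ℚ) / (Nat.card G : ℚ)

/-- The elementary abelian `2`-group `C₂ⁿ`. -/
abbrev C2pow (n : ℕ) : Type := Fin n → Multiplicative (ZMod 2)

/-- The symmetric group `S₃`. -/
abbrev S3 : Type := Equiv.Perm (Fin 3)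

/-- The dihedral group `D₈` of order `8`. -/
abbrev D8 : Type := DihedralGroup 4

/-- The family of finite non-abelian groups. -/
def nonAbelianGroups : Set FiniteGrp.{u} := {G | ¬ ∀ x y : G, x * y = y * x}

/-- The family of finite non-nilpotent groups. -/
def nonNilpotentGroups : Set FiniteGrp.{u} := {G | ¬ Group.IsNilpotent G}

/-- `a` is the maximum `α_𝓕 = max {α(G) : G ∈ 𝓕}`. -/
def IsMaxAlpha (F : Set FiniteGrp.{u}) (a : ℚ) : Prop :=
  IsGreatest {q : ℚ | ∃ G ∈ F, alpha G = q} a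

/-- The family `m𝓕` of the groups in `𝓕` at which the maximum of `α` on `𝓕` is attained. -/
def maximizers (F : Set FiniteGrp.{u}) : Set FiniteGrp.{u} :=
  {G | G ∈ F ∧ IsMaxAlpha F (alpha G)}

/-!
Write `φ` for Euler's totient function and `i(G)` for the number of `x : G` with `x ^ 2 = 1`. A
cyclic subgroup of order `d` has `φ d` generators, so `α(G)` is the average of `1 / φ (orderOf x)`
over `x : G`. This quantity is `1` when `x ^ 2 = 1` and at most `1 / 2` otherwise, so
`α(G) ≥ 5 / 6` forces `i(G) ≥ 2 |G| / 3`.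

Let `g ^ 2 = 1` with centralizer `C`. If `w ∉ C` and `w ^ 2 = 1`, then `g * w ∉ C` and
`(g * w) ^ 2 ≠ 1`, which gives `2 i(G) + |C| ≤ |G| + 2 i(C)`. Hence a noncentral such `g` has `C` of
index `2` or `3`, and then `i(C) > 3 |C| / 4`, which makes `C` an elementary abelian `2`-group.

If some index is `3`, then `g` and a conjugate of it outside `C` generate a copy of `S₃`; otherwise
`g` and any `w` as above generate a copy of `D₈`. In both cases the elements commuting with the two
generators contain an elementary abelian direct complement. If every such `g` is central, then `G`
itself is an elementary abelian `2`-group.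
-/

open Subgroup (zpowers)
open scoped Nat

section Counting

variable {G H : Type*} [Group G] [Group H]

lemma numCyclicSubgroups_congr (e : G ≃* H) : numCyclicSubgroups G = numCyclicSubgroups H :=
  Nat.card_congr (e.mapSubgroup.toEquiv.subtypeEquiv fun K => (e.subgroupMap K).isCyclic)

lemma alpha_congr (e : G ≃* H) : alpha G = alpha H := by
  rw [alpha, alpha, numCyclicSubgroups_congr e, Nat.card_congr e.toEquiv]

lemma ncard_setOf_zpowers_eq {x : G} (hx : IsOfFinOrder x) :
    {y : G | zpowers y = zpowers x}.ncard = φ (orderOf x) := by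
  classical
  have : Finite (zpowers x) := hx.finite_zpowers
  have := Fintype.ofFinite (zpowers x)
  have hcard : Fintype.card (zpowers x) = orderOf x := by
    rw [← Nat.card_eq_fintype_card, Nat.card_zpowers]
  have himage : {y : G | zpowers y = zpowers x} =
      Subtype.val '' {y : zpowers x | orderOf y = orderOf x} := by
    ext y
    simp only [Set.mem_ofPred_eq, Set.mem_image, Subtype.exists, Subgroup.orderOf_mk,
      exists_and_right, exists_eq_right]
    constructor
    · intro h
      exact ⟨h ▸ Subgroup.mem_zpowers y, by rw [← Nat.card_zpowers, h, Nat.card_zpowers]⟩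
    · rintro ⟨hy, ho⟩
      exact Subgroup.eq_of_le_of_card_ge (Subgroup.zpowers_le.2 hy)
        (by rw [Nat.card_zpowers, Nat.card_zpowers, ho])
  rw [himage, Set.ncard_image_of_injective _ Subtype.val_injective,
    ← IsCyclic.card_orderOf_eq_totient (α := zpowers x) hcard.symm.dvd,
    ← Set.ncard_coe_finset, Finset.coe_filter_univ]

lemma numCyclicSubgroups_eq_sum [Fintype G] :
    (numCyclicSubgroups G : ℚ) = ∑ x : G, (φ (orderOf x) : ℚ)⁻¹ := by
  classical
  have hcyclic :
      {K : Subgroup G | IsCyclic K} = Finset.univ.image (zpowers : G → Subgroup G) := by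
    ext K
    simp [Subgroup.isCyclic_iff_exists_zpowers_eq_top]
  have hfiber (x : G) :
      ∑ y : G with zpowers y = zpowers x, (φ (orderOf y) : ℚ)⁻¹ = 1 := by
    have hconst : ∀ y ∈ Finset.univ.filter fun y : G => zpowers y = zpowers x,
        (φ (orderOf y) : ℚ)⁻¹ = (φ (orderOf x) : ℚ)⁻¹ := fun y hy => by
      rw [← Nat.card_zpowers, (Finset.mem_filter.1 hy).2, Nat.card_zpowers]
    have hpos : (φ (orderOf x) : ℚ) ≠ 0 := by
      exact_mod_cast (Nat.totient_pos.2 (orderOf_pos x)).ne'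
    rw [Finset.sum_congr rfl hconst, Finset.sum_const, nsmul_eq_mul, ← Set.ncard_coe_finset,
      Finset.coe_filter_univ, ncard_setOf_zpowers_eq (isOfFinOrder_of_finite x),
      mul_inv_cancel₀ hpos]
  rw [numCyclicSubgroups, hcyclic, Set.ncard_coe_finset, Finset.cast_card]
  exact Finset.sum_image' _ fun x _ => (hfiber x).symm

lemma alpha_eq_sum_div [Fintype G] :
    alpha G = (∑ x : G, (φ (orderOf x) : ℚ)⁻¹) / Fintype.card G := by
  rw [alpha, numCyclicSubgroups_eq_sum, Nat.card_eq_fintype_card]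

lemma totient_lcm_of_dvd_two {d : ℕ} (hd : d ∣ 2) (m : ℕ) : φ (d.lcm m) = φ m := by
  rcases (Nat.dvd_prime Nat.prime_two).1 hd with rfl | rfl
  · rw [Nat.lcm_one_left]
  · rcases Nat.even_or_odd m with hm | hm
    · rw [Nat.lcm_eq_right hm.two_dvd]
    · rw [(Nat.coprime_two_left.2 hm).lcm_eq_mul, Nat.totient_two_mul_of_odd hm]

theorem alpha_prod_of_sq_eq_one {E : Type*} [Group E] [Finite E] [Finite G]
    (hE : ∀ x : E, x ^ 2 = 1) : alpha (E × G) = alpha G := by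
  have := Fintype.ofFinite E
  have := Fintype.ofFinite G
  have hcard : (Fintype.card E : ℚ) ≠ 0 := by exact_mod_cast Fintype.card_ne_zero
  have htotient (p : E × G) : φ (orderOf p) = φ (orderOf p.2) := by
    rw [Prod.orderOf, totient_lcm_of_dvd_two (orderOf_dvd_of_pow_eq_one (hE p.1))]
  simp only [alpha_eq_sum_div, htotient, Fintype.sum_prod_type, Finset.sum_const,
    Finset.card_univ, nsmul_eq_mul, Fintype.card_prod, Nat.cast_mul]
  rw [mul_div_mul_left _ _ hcard]

/-- The set of elements of order dividing `2`, that is, the involutions together with `1`. -/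
def sqRootsOfOne (G : Type*) [Group G] : Set G := {x | x ^ 2 = 1}

lemma totient_orderOf_eq_one_iff {x : G} : φ (orderOf x) = 1 ↔ x ∈ sqRootsOfOne G := by
  rw [Nat.totient_eq_one_iff, ← Nat.dvd_prime Nat.prime_two, orderOf_dvd_iff_pow_eq_one]
  rfl

open Classical in
lemma inv_totient_orderOf_le [Finite G] (x : G) :
    (φ (orderOf x) : ℚ)⁻¹ ≤ (1 + if x ∈ sqRootsOfOne G then 1 else 0) / 2 := by
  have hpos : 0 < φ (orderOf x) := Nat.totient_pos.2 (orderOf_pos x)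
  split_ifs with hx
  · norm_num [totient_orderOf_eq_one_iff.2 hx]
  · have hne : φ (orderOf x) ≠ 1 := mt totient_orderOf_eq_one_iff.1 hx
    have htwo : (2 : ℚ) ≤ φ (orderOf x) := by exact_mod_cast (by lia : 2 ≤ φ (orderOf x))
    linarith [inv_anti₀ two_pos htwo]

open Classical in
lemma inv_totient_orderOf_eq [Finite G] {x : G} (hx : φ (orderOf x) ≤ 2) :
    (φ (orderOf x) : ℚ)⁻¹ = (1 + if x ∈ sqRootsOfOne G then 1 else 0) / 2 := by
  have hpos : 0 < φ (orderOf x) := Nat.totient_pos.2 (orderOf_pos x)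
  rw [← totient_orderOf_eq_one_iff]
  interval_cases φ (orderOf x) <;> norm_num

open Classical in
lemma sum_one_add_ite_mem_div [Fintype G] (S : Set G) :
    (∑ x : G, (1 + if x ∈ S then 1 else 0 : ℚ) / 2) / Fintype.card G =
      (1 + S.ncard / Nat.card G) / 2 := by
  have hcard : (Fintype.card G : ℚ) ≠ 0 := by exact_mod_cast Fintype.card_ne_zero
  have hS : S.ncard = (Finset.univ.filter (· ∈ S)).card := by
    rw [← Set.ncard_coe_finset, Finset.coe_filter_univ, Set.ofPred_mem_eq]
  rw [← Finset.sum_div, Finset.sum_add_distrib, Finset.sum_boole, hS]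
  simp only [Finset.sum_const, Finset.card_univ, nsmul_eq_mul, mul_one, Nat.card_eq_fintype_card]
  field_simp

theorem alpha_le [Finite G] :
    alpha G ≤ (1 + (sqRootsOfOne G).ncard / Nat.card G) / 2 := by
  have := Fintype.ofFinite G
  rw [alpha_eq_sum_div, ← sum_one_add_ite_mem_div]
  gcongr with x
  exact inv_totient_orderOf_le x

theorem alpha_eq_of_totient_le_two [Finite G] (hG : ∀ x : G, φ (orderOf x) ≤ 2) :
    alpha G = (1 + (sqRootsOfOne G).ncard / Nat.card G) / 2 := by
  have := Fintype.ofFinite G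
  simp only [alpha_eq_sum_div, ← sum_one_add_ite_mem_div, inv_totient_orderOf_eq (hG _)]

theorem alpha_eq_one_of_sq_eq_one [Finite G] (hG : ∀ x : G, x ^ 2 = 1) : alpha G = 1 := by
  have hcard : (Nat.card G : ℚ) ≠ 0 := by exact_mod_cast Nat.card_pos.ne'
  have huniv : sqRootsOfOne G = Set.univ := Set.eq_univ_of_forall hG
  rw [alpha_eq_of_totient_le_two fun x => (totient_orderOf_eq_one_iff.2 (hG x)).trans_le one_le_two,
    huniv, Set.ncard_univ, div_self hcard]
  norm_num

theorem two_mul_card_le_of_le_alpha [Finite G] (h : 5 / 6 ≤ alpha G) :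
    2 * Nat.card G ≤ 3 * (sqRootsOfOne G).ncard := by
  have hcard : (0 : ℚ) < Nat.card G := by exact_mod_cast Nat.card_pos
  have hratio : (2 / 3 : ℚ) ≤ (sqRootsOfOne G).ncard / Nat.card G := by
    linarith [alpha_le (G := G)]
  rw [div_le_div_iff₀ three_pos hcard] at hratio
  exact_mod_cast (mul_comm _ (3 : ℚ)).symm ▸ hratio

end Counting

section Values

theorem alpha_S3 : alpha S3 = 5 / 6 := by
  have hcard : Nat.card S3 = 6 := by rw [Nat.card_perm, Nat.card_fin]; rfl
  have horder (x : S3) : φ (orderOf x) ≤ 2 := by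
    have hdvd : orderOf x ∣ 6 := hcard ▸ orderOf_dvd_natCard x
    exact Nat.le_of_dvd two_pos (Nat.totient_dvd_of_dvd hdvd)
  have hncard : (sqRootsOfOne S3).ncard = 4 := by
    rw [sqRootsOfOne, ← Finset.coe_filter_univ, Set.ncard_coe_finset]
    decide
  rw [alpha_eq_of_totient_le_two horder, hncard, hcard]
  norm_num

theorem alpha_D8 : alpha D8 = 7 / 8 := by
  have horder (x : D8) : φ (orderOf x) ≤ 2 := by
    have hdvd : orderOf x ∣ 4 := orderOf_dvd_of_pow_eq_one ((by decide : ∀ x : D8, x ^ 4 = 1) x)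
    exact Nat.le_of_dvd two_pos (Nat.totient_dvd_of_dvd hdvd)
  have hncard : (sqRootsOfOne D8).ncard = 6 := by
    rw [sqRootsOfOne, ← Finset.coe_filter_univ, Set.ncard_coe_finset]
    decide
  rw [alpha_eq_of_totient_le_two horder, hncard, DihedralGroup.nat_card]
  norm_num

lemma sq_eq_one_of_C2pow {n : ℕ} (x : C2pow n) : x ^ 2 = 1 :=
  funext fun i => (by decide : ∀ y : Multiplicative (ZMod 2), y ^ 2 = 1) (x i)

lemma alpha_C2pow (n : ℕ) : alpha (C2pow n) = 1 :=
  alpha_eq_one_of_sq_eq_one sq_eq_one_of_C2pow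

lemma alpha_C2pow_prod_S3 (n : ℕ) : alpha (C2pow n × S3) = 5 / 6 :=
  (alpha_prod_of_sq_eq_one sq_eq_one_of_C2pow).trans alpha_S3

lemma alpha_C2pow_prod_D8 (n : ℕ) : alpha (C2pow n × D8) = 7 / 8 :=
  (alpha_prod_of_sq_eq_one sq_eq_one_of_C2pow).trans alpha_D8

end Values

section SqRootsOfOne

variable {G : Type*} [Group G] {g h : G}

lemma mem_sqRootsOfOne : g ∈ sqRootsOfOne G ↔ g ^ 2 = 1 := Iff.rfl

lemma inv_eq_self_iff_sq_eq_one : g⁻¹ = g ↔ g ^ 2 = 1 := by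
  rw [sq, mul_eq_one_iff_inv_eq]

lemma commute_of_sq_eq_one (hg : g ^ 2 = 1) (hh : h ^ 2 = 1) (hgh : (g * h) ^ 2 = 1) :
    Commute g h := by
  rw [← inv_eq_self_iff_sq_eq_one] at hg hh hgh
  rw [commute_iff_eq, ← hgh, mul_inv_rev, hg, hh]

lemma ncard_sqRootsOfOne_subgroup (K : Subgroup G) :
    (sqRootsOfOne K).ncard = (sqRootsOfOne G ∩ K).ncard := by
  rw [← Set.ncard_image_of_injective _ K.subtype_injective]
  congr 1
  ext x
  simp [sqRootsOfOne, Subtype.ext_iff, and_comm]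

variable [Finite G]

lemma eq_top_of_card_lt_two_mul {K : Subgroup G} (hK : Nat.card G < 2 * Nat.card K) : K = ⊤ := by
  by_contra hne
  have hindex : 2 ≤ K.index := Subgroup.one_lt_index_of_ne_top hne
  nlinarith [K.card_mul_index, Nat.card_pos (α := K)]

lemma eq_top_of_sqRootsOfOne_subset {K : Subgroup G} (hK : sqRootsOfOne G ⊆ K)
    (hcard : Nat.card G < 2 * (sqRootsOfOne G).ncard) : K = ⊤ :=
  eq_top_of_card_lt_two_mul (hcard.trans_le (Nat.mul_le_mul_left 2 (Set.ncard_le_ncard hK)))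

theorem sq_eq_one_of_sqRootsOfOne_subset_center (hcenter : sqRootsOfOne G ⊆ Subgroup.center G)
    (hcard : Nat.card G < 2 * (sqRootsOfOne G).ncard) (x : G) : x ^ 2 = 1 := by
  let K : Subgroup G :=
    { carrier := sqRootsOfOne G
      one_mem' := one_pow 2
      mul_mem' := fun {a b} ha hb => by
        have hab : Commute a b := Subgroup.mem_center_iff.1 (hcenter hb) a
        rw [mem_sqRootsOfOne] at *
        rw [hab.mul_pow, ha, hb, one_mul]
      inv_mem' := fun {a} ha => (inv_eq_self_iff_sq_eq_one.2 ha).symm ▸ ha }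
  have hK : K = ⊤ := eq_top_of_sqRootsOfOne_subset subset_rfl hcard
  have hx : x ∈ K := hK ▸ Subgroup.mem_top x
  exact hx

-- For an involution `g`, left multiplication by `g` moves the square roots of `1` outside the
-- centralizer of `g` to elements of order greater than `2`, still outside the centralizer.
theorem two_mul_ncard_sqRootsOfOne_add_card_centralizer_le (hg : g ∈ sqRootsOfOne G) :
    2 * (sqRootsOfOne G).ncard + Nat.card (Subgroup.centralizer {g}) ≤
      Nat.card G + 2 * (sqRootsOfOne (Subgroup.centralizer {g})).ncard := by
  set C := Subgroup.centralizer {g}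
  have hgC : g ∈ C := Subgroup.mem_centralizer_singleton_iff.2 rfl
  set A := sqRootsOfOne G \ C
  have hdisjoint : Disjoint A ((g * ·) '' A) := by
    rw [Set.disjoint_right]
    rintro _ ⟨x, hx, rfl⟩ hgx
    exact hx.2 (Subgroup.mem_centralizer_singleton_iff.2
      (commute_of_sq_eq_one hg hx.1 hgx.1).symm)
  have hsubset : A ∪ (g * ·) '' A ⊆ (C : Set G)ᶜ := by
    refine Set.union_subset (fun x hx => hx.2) ?_
    rintro _ ⟨x, hx, rfl⟩ hgx
    exact hx.2 ((C.mul_mem_cancel_left hgC).1 hgx)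
  have hle := Set.ncard_le_ncard hsubset
  rw [Set.ncard_union_eq hdisjoint, Set.ncard_image_of_injective _ (mul_right_injective g)] at hle
  have hcompl := Set.ncard_add_ncard_compl (C : Set G)
  have hsplit := Set.ncard_inter_add_ncard_sdiff_eq_ncard (sqRootsOfOne G) (C : Set G)
  have hcardC : (C : Set G).ncard = Nat.card C := rfl
  rw [ncard_sqRootsOfOne_subgroup]
  lia

lemma two_mul_ncard_sqRootsOfOne_le (hg : g ∈ sqRootsOfOne G) :
    2 * (sqRootsOfOne G).ncard ≤ Nat.card G + Nat.card (Subgroup.centralizer {g}) := by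
  have hle := Set.ncard_le_card (sqRootsOfOne (Subgroup.centralizer {g}))
  have := two_mul_ncard_sqRootsOfOne_add_card_centralizer_le hg
  lia

theorem sq_eq_one_of_three_mul_card_lt (hcard : 3 * Nat.card G < 4 * (sqRootsOfOne G).ncard)
    (x : G) : x ^ 2 = 1 := by
  refine sq_eq_one_of_sqRootsOfOne_subset_center (fun g hg => ?_) (by lia) x
  have hcentralizer : Subgroup.centralizer {g} = ⊤ :=
    eq_top_of_card_lt_two_mul (by have := two_mul_ncard_sqRootsOfOne_le hg; lia)
  exact Subgroup.centralizer_eq_top_iff_subset.1 hcentralizer rfl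

theorem index_centralizer_le_three (hcard : 2 * Nat.card G ≤ 3 * (sqRootsOfOne G).ncard)
    (hg : g ∈ sqRootsOfOne G) : (Subgroup.centralizer {g}).index ≤ 3 := by
  have hle := two_mul_ncard_sqRootsOfOne_le hg
  have hindex := (Subgroup.centralizer {g}).card_mul_index
  have hpos : 0 < Nat.card (Subgroup.centralizer {g}) := Nat.card_pos
  nlinarith

theorem sq_eq_one_of_mem_centralizer (hcard : 2 * Nat.card G ≤ 3 * (sqRootsOfOne G).ncard)
    (hg : g ∈ sqRootsOfOne G) (hne : Subgroup.centralizer {g} ≠ ⊤) {a : G}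
    (ha : a ∈ Subgroup.centralizer {g}) : a ^ 2 = 1 := by
  have hle := two_mul_ncard_sqRootsOfOne_add_card_centralizer_le hg
  have htwo : 1 < (Subgroup.centralizer {g}).index := Subgroup.one_lt_index_of_ne_top hne
  have hthree := index_centralizer_le_three hcard hg
  have hmul := (Subgroup.centralizer {g}).card_mul_index
  have hpos : 0 < Nat.card (Subgroup.centralizer {g}) := Nat.card_pos
  have hlt : 3 * Nat.card (Subgroup.centralizer {g}) <
      4 * (sqRootsOfOne (Subgroup.centralizer {g})).ncard := by
    interval_cases (Subgroup.centralizer {g}).index <;> lia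
  exact congrArg Subtype.val (sq_eq_one_of_three_mul_card_lt hlt ⟨a, ha⟩)

end SqRootsOfOne

section DihedralProducts

theorem exists_mulEquiv_C2pow {G : Type*} [Group G] [Finite G] (hG : ∀ x : G, x ^ 2 = 1) :
    ∃ n : ℕ, Nonempty (G ≃* C2pow n) := by
  let _ : CommGroup G :=
    { ‹Group G› with
      mul_comm := fun a b =>
        Commute.of_orderOf_dvd_two (fun x => orderOf_dvd_of_pow_eq_one (hG x)) a b |>.eq }
  let _ : Module (ZMod 2) (Additive G) := AddCommGroup.zmodModule (n := 2) hG
  exact ⟨_, ⟨(AddEquiv.toMultiplicativeRight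
    (Module.finBasis (ZMod 2) (Additive G)).equivFun.toAddEquiv).trans
      (MulEquiv.piMultiplicative _)⟩⟩

variable {G : Type*} [Group G] {a b : G} {n : ℕ}

lemma zpow_zmodCast_intCast {t : G} (ht : t ^ n = 1) (k : ℤ) :
    t ^ ((k : ZMod n).cast : ℤ) = t ^ k := by
  rw [ZMod.coe_intCast, ← zpow_eq_zpow_emod' k ht]

lemma semiconjBy_mul_zpow (ha : a ^ 2 = 1) (hb : b ^ 2 = 1) (k : ℤ) :
    SemiconjBy a ((a * b) ^ k) ((a * b) ^ (-k)) := by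
  have hinv : SemiconjBy a (a * b) (a * b)⁻¹ := by
    rw [SemiconjBy, mul_inv_rev, inv_mul_cancel_right, ← mul_assoc, ← sq, ha, one_mul,
      inv_eq_self_iff_sq_eq_one.2 hb]
  rw [zpow_neg, ← inv_zpow]
  exact hinv.zpow_right k

lemma commute_of_commute_mul_zpow {k : ℤ} (h : Commute (a * (a * b) ^ k) (a * b)) :
    Commute a b := by
  have hamul : Commute a (a * b) := by
    simpa only [mul_inv_cancel_right] using
      h.mul_left ((Commute.refl (a * b)).zpow_left k).inv_left
  simpa only [inv_mul_cancel_left] using (Commute.refl a).inv_right.mul_right hamul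

/-- The homomorphism from the dihedral group of order `2 * n` determined by two elements `a` and `b`
of order dividing `2` whose product has order dividing `n`: it maps the reflections `sr 0` and
`sr 1` to `a` and `a * (a * b) = b`, hence the rotation `r 1 = sr 0 * sr 1` to `a * b`. -/
def dihedralLift (a b : G) (ha : a ^ 2 = 1) (hb : b ^ 2 = 1) (hab : (a * b) ^ n = 1) :
    DihedralGroup n →* G where
  toFun
    | .r i => (a * b) ^ (i.cast : ℤ)
    | .sr i => a * (a * b) ^ (i.cast : ℤ)
  map_one' := by
    change (a * b) ^ ((0 : ZMod n).cast : ℤ) = 1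
    rw [ZMod.cast_zero, zpow_zero]
  map_mul' := by
    have hcomm (k : ℤ) : (a * b) ^ k * a = a * (a * b) ^ (-k) := by
      rw [(semiconjBy_mul_zpow ha hb (-k)).eq, neg_neg]
    rintro (i | i) (j | j) <;> obtain ⟨k, rfl⟩ := ZMod.intCast_surjective i <;>
      obtain ⟨l, rfl⟩ := ZMod.intCast_surjective j
    · simp only [DihedralGroup.r_mul_r, ← Int.cast_add, zpow_zmodCast_intCast hab, zpow_add]
    · simp only [DihedralGroup.r_mul_sr, ← Int.cast_sub, zpow_zmodCast_intCast hab]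
      rw [← mul_assoc, hcomm, mul_assoc, ← zpow_add, neg_add_eq_sub]
    · simp only [DihedralGroup.sr_mul_r, ← Int.cast_add, zpow_zmodCast_intCast hab]
      rw [mul_assoc, ← zpow_add]
    · simp only [DihedralGroup.sr_mul_sr, ← Int.cast_sub, zpow_zmodCast_intCast hab]
      rw [mul_assoc, ← mul_assoc _ a, hcomm, mul_assoc a, ← mul_assoc a a, ← sq, ha, one_mul,
        ← zpow_add, neg_add_eq_sub]

lemma dihedralLift_injective (ha : a ^ 2 = 1) (hb : b ^ 2 = 1) (hab : ¬ Commute a b)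
    (hn : orderOf (a * b) = n) :
    Function.Injective (dihedralLift a b ha hb (hn ▸ pow_orderOf_eq_one (a * b))) := by
  have hpow : (a * b) ^ n = 1 := hn ▸ pow_orderOf_eq_one (a * b)
  rw [injective_iff_map_eq_one]
  rintro (i | i) hi <;> obtain ⟨k, rfl⟩ := ZMod.intCast_surjective i
  · change (a * b) ^ ((k : ZMod n).cast : ℤ) = 1 at hi
    rw [zpow_zmodCast_intCast hpow, ← orderOf_dvd_iff_zpow_eq_one, hn] at hi
    rw [(ZMod.intCast_zmod_eq_zero_iff_dvd k n).2 hi, DihedralGroup.r_zero]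
  · exact absurd (commute_of_commute_mul_zpow (hi.symm ▸ Commute.one_left (a * b))) hab

theorem nonempty_dihedralGroup_three_mulEquiv_S3 : Nonempty (DihedralGroup 3 ≃* S3) := by
  have horder : orderOf (Equiv.swap 0 1 * Equiv.swap 1 2 : S3) = 3 :=
    orderOf_eq_prime (by decide) (by decide)
  have hcomm : ¬ Commute (Equiv.swap 0 1 : S3) (Equiv.swap 1 2) :=
    (by decide : (Equiv.swap 0 1 * Equiv.swap 1 2 : S3) ≠ Equiv.swap 1 2 * Equiv.swap 0 1)
  have hcard : Nat.card S3 ≤ Nat.card (DihedralGroup 3) := by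
    rw [DihedralGroup.nat_card, Nat.card_perm, Nat.card_fin]
    rfl
  exact ⟨.ofBijective _ <| (dihedralLift_injective (by decide) (by decide) hcomm
    horder).bijective_of_nat_card_le hcard⟩

lemma commute_dihedralLift {x : G} (ha : a ^ 2 = 1) (hb : b ^ 2 = 1) (hab : (a * b) ^ n = 1)
    (hxa : Commute x a) (hxb : Commute x b) (d : DihedralGroup n) :
    Commute x (dihedralLift a b ha hb hab d) := by
  rcases d with i | i
  · exact (hxa.mul_right hxb).zpow_right _
  · exact hxa.mul_right ((hxa.mul_right hxb).zpow_right _)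

lemma disjoint_range_dihedralLift {N : Subgroup G} (ha : a ^ 2 = 1) (hb : b ^ 2 = 1)
    (hpow : (a * b) ^ n = 1) (hab : ¬ Commute a b) (hN : ∀ x ∈ N, Commute x (a * b))
    (hdisjoint : Disjoint N (zpowers (a * b))) :
    Disjoint N (dihedralLift a b ha hb hpow).range := by
  refine Subgroup.disjoint_def.2 fun {x} hx => ?_
  rintro ⟨i | i, rfl⟩
  · exact Subgroup.disjoint_def.1 hdisjoint hx (Subgroup.zpow_mem_zpowers _ _)
  · exact absurd (commute_of_commute_mul_zpow (hN _ hx)) hab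

theorem exists_mulEquiv_C2pow_prod_dihedralGroup [Finite G] {N : Subgroup G}
    (hN : ∀ x ∈ N, x ^ 2 = 1) (ha : a ^ 2 = 1) (hb : b ^ 2 = 1) (hab : ¬ Commute a b)
    (hNab : N ≤ Subgroup.centralizer {a} ⊓ Subgroup.centralizer {b}) (hn : orderOf (a * b) = n)
    (hdisjoint : Disjoint N (zpowers (a * b))) (hindex : N.index ≤ 2 * n) :
    ∃ m : ℕ, Nonempty (G ≃* C2pow m × DihedralGroup n) := by
  have hpow : (a * b) ^ n = 1 := hn ▸ pow_orderOf_eq_one (a * b)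
  let f : DihedralGroup n →* G := dihedralLift a b ha hb hpow
  have hNa (x : G) (hx : x ∈ N) : Commute x a :=
    Subgroup.mem_centralizer_singleton_iff.1 (hNab hx).1
  have hNb (x : G) (hx : x ∈ N) : Commute x b :=
    Subgroup.mem_centralizer_singleton_iff.1 (hNab hx).2
  have hcommute (x : N) (d : DihedralGroup n) : Commute (x : G) (f d) :=
    commute_dihedralLift ha hb hpow (hNa x x.2) (hNb x x.2) d
  have hinjective : Function.Injective (N.subtype.noncommCoprod f hcommute) :=
    (MonoidHom.noncommCoprod_injective _ _ _).2 ⟨N.subtype_injective,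
      dihedralLift_injective ha hb hab hn,
      N.range_subtype.symm ▸ disjoint_range_dihedralLift ha hb hpow hab
        (fun x hx => (hNa x hx).mul_right (hNb x hx)) hdisjoint⟩
  have hcard : Nat.card G ≤ Nat.card (N × DihedralGroup n) := by
    rw [Nat.card_prod, DihedralGroup.nat_card, ← N.card_mul_index]
    exact Nat.mul_le_mul_left _ hindex
  obtain ⟨m, ⟨e⟩⟩ := exists_mulEquiv_C2pow fun x : N => Subtype.ext (hN x x.2)
  exact ⟨m, ⟨(MulEquiv.ofBijective _ (hinjective.bijective_of_nat_card_le hcard)).symm.trans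
    (e.prodCongr (.refl _))⟩⟩

end DihedralProducts

section Classification

variable {G : Type*} [Group G] {A B : Subgroup G} {g h w : G}

lemma mem_of_mem_normalizer_of_odd_index (hodd : Odd A.index) (hw : w ^ 2 = 1)
    (hwA : w ∈ Subgroup.normalizer (A : Set G)) : w ∈ A := by
  let B := A.subgroupOf (Subgroup.normalizer (A : Set G))
  obtain ⟨k, hk⟩ : Odd B.index :=
    hodd.of_dvd_nat (Subgroup.relIndex_dvd_index_of_le A.le_normalizer)
  have hpow : w ^ B.index ∈ A := B.pow_index_mem ⟨w, hwA⟩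
  rwa [hk, pow_succ, pow_mul, hw, one_pow, one_mul] at hpow

-- The centralizer of `g` is abelian. If the conjugate of `g` by `w` lay in it, then `w` would
-- normalize it, hence lie in it because its index is odd.
lemma conj_notMem_centralizer (hg : ∀ a ∈ Subgroup.centralizer {g}, a ^ 2 = 1)
    (hodd : Odd (Subgroup.centralizer {g}).index) (hw : w ^ 2 = 1)
    (hwg : w ∉ Subgroup.centralizer {g}) : w * g * w⁻¹ ∉ Subgroup.centralizer {g} := by
  intro hconj
  have hconj_conj (x : G) : w * (w * x * w⁻¹) * w⁻¹ = x := by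
    rw [← mul_assoc, ← mul_assoc, ← sq, hw, one_mul, mul_assoc, ← mul_inv_rev, ← sq, hw, inv_one,
      mul_one]
  have hmaps (a : G) (ha : a ∈ Subgroup.centralizer {g}) :
      w * a * w⁻¹ ∈ Subgroup.centralizer {g} := by
    have hcomm : Commute a (w * g * w⁻¹) :=
      commute_of_sq_eq_one (hg a ha) (hg _ hconj) (hg _ (mul_mem ha hconj))
    rw [← Commute.conj_iff w, hconj_conj] at hcomm
    exact Subgroup.mem_centralizer_singleton_iff.2 hcomm
  exact hwg (mem_of_mem_normalizer_of_odd_index hodd hw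
    (Subgroup.mem_normalizer_iff.2 fun a => ⟨hmaps a, fun ha => hconj_conj a ▸ hmaps _ ha⟩))

lemma orderOf_mul_conj_eq_three (hg : ∀ a ∈ Subgroup.centralizer {g}, a ^ 2 = 1)
    (hindex : (Subgroup.centralizer {g}).index = 3) (hw : w ^ 2 = 1)
    (hconj : w * g * w⁻¹ ∉ Subgroup.centralizer {g}) : orderOf (g * (w * g * w⁻¹)) = 3 := by
  have hg2 : g ^ 2 = 1 := hg g (Subgroup.mem_centralizer_singleton_iff.2 rfl)
  have hsq : g * (w * g * w⁻¹) = (g * w) ^ 2 := by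
    rw [inv_eq_self_iff_sq_eq_one.2 hw, sq, mul_assoc, mul_assoc]
  have hne_one : (g * (w * g * w⁻¹)) ^ 2 ≠ 1 := fun hone =>
    hconj (Subgroup.mem_centralizer_singleton_iff.2
      (commute_of_sq_eq_one hg2 (by rw [conj_pow, hg2, mul_one, mul_inv_cancel]) hone).symm)
  obtain ⟨n, hn0, hn3, hn⟩ := Subgroup.exists_pow_mem_of_index_ne_zero
    (H := Subgroup.centralizer {g}) (by lia) (g * w)
  have hpow : (g * (w * g * w⁻¹)) ^ n = 1 := by
    rw [hsq, ← pow_mul, mul_comm, pow_mul, hg _ hn]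
  rw [hindex] at hn3
  interval_cases n
  · rw [pow_one] at hpow
    exact absurd (by rw [hpow, one_pow]) hne_one
  · exact absurd hpow hne_one
  · exact orderOf_eq_prime hpow fun hone => hne_one (by rw [hone, one_pow])

lemma orderOf_mul_eq_four (hg : g ^ 2 = 1) (hh : h ^ 2 = 1) (hgh : ¬ Commute g h)
    (hpow : ((g * h) ^ 2) ^ 2 = 1) : orderOf (g * h) = 4 :=
  orderOf_eq_prime_pow (p := 2) (n := 1) (fun hone => hgh (commute_of_sq_eq_one hg hh hone))
    (by rwa [← pow_mul] at hpow)

lemma disjoint_zpowers_of_sq_notMem {t : G} (hA : ∀ a ∈ A, a ^ 2 = 1) (ht : orderOf t = 4)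
    (htA : t ^ 2 ∉ A) : Disjoint A (zpowers t) := by
  refine Subgroup.disjoint_def.2 fun {x} hx hxt => ?_
  obtain ⟨k, rfl⟩ := Subgroup.mem_zpowers_iff.1 hxt
  have hdvd : (4 : ℤ) ∣ 2 * k := by
    rw [← Nat.cast_ofNat, ← ht, orderOf_dvd_iff_zpow_eq_one, mul_comm, zpow_mul]
    exact_mod_cast hA _ hx
  obtain ⟨j, rfl⟩ : (2 : ℤ) ∣ k := by lia
  have hsq : (t ^ 2) ^ 2 = 1 := by
    rw [← pow_mul]
    exact orderOf_dvd_iff_pow_eq_one.1 ht.dvd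
  rw [zpow_mul, zpow_ofNat] at hx ⊢
  rcases j.even_or_odd' with ⟨i, rfl | rfl⟩
  · rw [zpow_mul, zpow_ofNat, hsq, one_zpow]
  · rw [zpow_add_one, zpow_mul, zpow_ofNat, hsq, one_zpow, one_mul] at hx
    exact absurd hx htA

variable [Finite G]

lemma not_dvd_card_of_sq_eq_one {p : ℕ} [Fact p.Prime] (hp : p ≠ 2) (hG : ∀ x : G, x ^ 2 = 1) :
    ¬ p ∣ Nat.card G := by
  intro hdvd
  obtain ⟨x, hx⟩ := exists_prime_orderOf_dvd_card' p hdvd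
  exact hp ((Nat.prime_dvd_prime_iff_eq Fact.out Nat.prime_two).1
    (hx ▸ orderOf_dvd_of_pow_eq_one (hG x)))

lemma index_inf_le_of_not_dvd_card {m n : ℕ} (hA : A.index ≤ m) (hB : B.index ≤ n)
    (hn : ¬ n ∣ Nat.card A) : (A ⊓ B).index ≤ (n - 1) * m := by
  have hle : B.relIndex A ≤ n :=
    (Subgroup.relIndex_le_of_le_right le_top Subgroup.FiniteIndex.index_ne_zero).trans
      (B.relIndex_top_right.trans_le hB)
  have hlt : B.relIndex A < n :=
    hle.lt_of_ne fun heq => hn (heq ▸ Subgroup.relIndex_dvd_card B A)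
  rw [← Subgroup.relIndex_mul_index inf_le_left, Subgroup.inf_relIndex_left]
  exact Nat.mul_le_mul (Nat.le_sub_one_of_lt hlt) hA

lemma exists_notMem_of_ne_top (hcard : Nat.card G < 2 * (sqRootsOfOne G).ncard) (hA : A ≠ ⊤) :
    ∃ w ∈ sqRootsOfOne G, w ∉ A :=
  Set.not_subset.1 fun hsubset => hA (eq_top_of_sqRootsOfOne_subset hsubset hcard)

theorem exists_mulEquiv_C2pow_prod_S3 (hcard : 2 * Nat.card G ≤ 3 * (sqRootsOfOne G).ncard)
    (hg : g ∈ sqRootsOfOne G) (hindex : (Subgroup.centralizer {g}).index = 3) :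
    ∃ n : ℕ, Nonempty (G ≃* C2pow n × S3) := by
  have hne : Subgroup.centralizer {g} ≠ ⊤ := fun htop => by
    rw [htop, Subgroup.index_top] at hindex
    norm_num at hindex
  have hsq (a : G) (ha : a ∈ Subgroup.centralizer {g}) : a ^ 2 = 1 :=
    sq_eq_one_of_mem_centralizer hcard hg hne ha
  obtain ⟨w, hw, hwg⟩ := exists_notMem_of_ne_top (by have := Nat.card_pos (α := G); lia) hne
  have hconj := conj_notMem_centralizer hsq (hindex ▸ by decide) hw hwg
  have horder := orderOf_mul_conj_eq_three hsq hindex hw hconj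
  have hh : (w * g * w⁻¹) ^ 2 = 1 := by
    rw [conj_pow, mem_sqRootsOfOne.1 hg, mul_one, mul_inv_cancel]
  have hthree : ¬ 3 ∣ Nat.card (Subgroup.centralizer {g}) :=
    not_dvd_card_of_sq_eq_one (by decide) fun a => Subtype.ext (hsq a a.2)
  set N := Subgroup.centralizer {g} ⊓ Subgroup.centralizer {w * g * w⁻¹}
  have hdisjoint : Disjoint N (zpowers (g * (w * g * w⁻¹))) := by
    refine Subgroup.disjoint_of_coprime_natCard (Nat.Coprime.symm ?_)
    rw [Nat.card_zpowers, horder, Nat.prime_three.coprime_iff_not_dvd]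
    exact fun hdvd => hthree (hdvd.trans (Subgroup.card_dvd_of_le inf_le_left))
  obtain ⟨n, ⟨e⟩⟩ := exists_mulEquiv_C2pow_prod_dihedralGroup (N := N) (fun x hx => hsq x hx.1)
    hg hh (fun hcomm => hconj (Subgroup.mem_centralizer_singleton_iff.2 hcomm.symm)) le_rfl horder
    hdisjoint (index_inf_le_of_not_dvd_card hindex.le (index_centralizer_le_three hcard hh) hthree)
  obtain ⟨f⟩ := nonempty_dihedralGroup_three_mulEquiv_S3
  exact ⟨n, ⟨e.trans ((MulEquiv.refl _).prodCongr f)⟩⟩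

lemma sq_mem_of_index_le_two (hA : A.index ≤ 2) (x : G) : x ^ 2 ∈ A := by
  have hpos : 0 < A.index := Nat.pos_of_ne_zero Subgroup.FiniteIndex.index_ne_zero
  rcases (by lia : A.index = 1 ∨ A.index = 2) with hone | htwo
  · exact Subgroup.index_eq_one.1 hone ▸ Subgroup.mem_top _
  · exact Subgroup.sq_mem_of_index_two htwo x

lemma exists_index_le_two_notMem (hG : ∀ x : G, x ^ 2 = 1) {z : G} (hz : z ≠ 1) :
    ∃ M : Subgroup G, M.index ≤ 2 ∧ z ∉ M := by
  obtain ⟨n, ⟨e⟩⟩ := exists_mulEquiv_C2pow hG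
  obtain ⟨i, hi⟩ := Function.ne_iff.1 (e.map_ne_one_iff.2 hz)
  let f : G →* Multiplicative (ZMod 2) :=
    (Pi.evalMonoidHom (fun _ : Fin n => Multiplicative (ZMod 2)) i).comp e.toMonoidHom
  refine ⟨f.ker, ?_, hi⟩
  rw [Subgroup.index_ker]
  exact (Subgroup.card_le_card_group f.range).trans_eq (Nat.card_zmod 2)

theorem exists_mulEquiv_C2pow_prod_D8 (hcard : 2 * Nat.card G ≤ 3 * (sqRootsOfOne G).ncard)
    (hindex : ∀ x ∈ sqRootsOfOne G, (Subgroup.centralizer {x}).index ≤ 2)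
    (hg : g ∈ sqRootsOfOne G) (hne : Subgroup.centralizer {g} ≠ ⊤) :
    ∃ n : ℕ, Nonempty (G ≃* C2pow n × D8) := by
  have hsq (a : G) (ha : a ∈ Subgroup.centralizer {g}) : a ^ 2 = 1 :=
    sq_eq_one_of_mem_centralizer hcard hg hne ha
  obtain ⟨w, hw, hwg⟩ := exists_notMem_of_ne_top (by have := Nat.card_pos (α := G); lia) hne
  have hcomm : ¬ Commute g w := fun hc => hwg (Subgroup.mem_centralizer_singleton_iff.2 hc.symm)
  have hsq_mem {x : G} (hx : x ∈ sqRootsOfOne G) : (g * w) ^ 2 ∈ Subgroup.centralizer {x} :=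
    sq_mem_of_index_le_two (hindex x hx) (g * w)
  have horder : orderOf (g * w) = 4 := orderOf_mul_eq_four hg hw hcomm (hsq _ (hsq_mem hg))
  set Z := Subgroup.centralizer {g} ⊓ Subgroup.centralizer {w}
  have hZ (z : Z) : z ^ 2 = 1 := Subtype.ext (hsq z z.2.1)
  -- `M` is a complement of the subgroup generated by `(g * w) ^ 2` in `Z`.
  obtain ⟨M, hM, hsqM⟩ := exists_index_le_two_notMem hZ
    (z := ⟨(g * w) ^ 2, hsq_mem hg, hsq_mem hw⟩)
    fun hone => hcomm (commute_of_sq_eq_one hg hw (congrArg Subtype.val hone))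
  have hle : M.map Z.subtype ≤ Z := Subgroup.map_subtype_le M
  have hmem_sq (x : G) (hx : x ∈ M.map Z.subtype) : x ^ 2 = 1 := hsq x (hle hx).1
  have hsqN : (g * w) ^ 2 ∉ M.map Z.subtype := fun hmem =>
    hsqM ((Subgroup.mem_map_iff_mem Z.subtype_injective).1 hmem)
  refine exists_mulEquiv_C2pow_prod_dihedralGroup hmem_sq hg hw hcomm hle horder
    (disjoint_zpowers_of_sq_notMem hmem_sq horder hsqN) ?_
  have hZindex : Z.index ≤ 2 * 2 :=
    Subgroup.index_inf_le.trans (Nat.mul_le_mul (hindex g hg) (hindex w hw))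
  rw [Subgroup.index_map_subtype]
  exact Nat.mul_le_mul hM hZindex

theorem exists_mulEquiv_of_two_mul_card_le
    (hcard : 2 * Nat.card G ≤ 3 * (sqRootsOfOne G).ncard) :
    (∃ n : ℕ, Nonempty (G ≃* C2pow n × S3)) ∨ (∃ n : ℕ, Nonempty (G ≃* C2pow n × D8)) ∨
      ∃ n : ℕ, Nonempty (G ≃* C2pow n) := by
  by_cases hcentral : ∀ g ∈ sqRootsOfOne G, Subgroup.centralizer {g} = ⊤
  · refine .inr (.inr (exists_mulEquiv_C2pow
      (sq_eq_one_of_sqRootsOfOne_subset_center (fun g hg => ?_) ?_)))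
    · exact Subgroup.centralizer_eq_top_iff_subset.1 (hcentral g hg) rfl
    · have := Nat.card_pos (α := G)
      lia
  push Not at hcentral
  obtain ⟨g, hg, hne⟩ := hcentral
  by_cases htwo : ∀ x ∈ sqRootsOfOne G, (Subgroup.centralizer {x}).index ≤ 2
  · exact .inr (.inl (exists_mulEquiv_C2pow_prod_D8 hcard htwo hg hne))
  push Not at htwo
  obtain ⟨x, hx, hthree⟩ := htwo
  exact .inl (exists_mulEquiv_C2pow_prod_S3 hcard hx
    ((index_centralizer_le_three hcard hx).antisymm hthree))

end Classification

theorem classification_of_le_alpha (G : Type*) [Group G] [Finite G] (h : 5 / 6 ≤ alpha G) :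
    ((∃ n : ℕ, Nonempty (G ≃* C2pow n × S3)) ∧ alpha G = 5 / 6) ∨
    ((∃ n : ℕ, Nonempty (G ≃* C2pow n × D8)) ∧ alpha G = 7 / 8) ∨
    ((∃ n : ℕ, Nonempty (G ≃* C2pow n)) ∧ alpha G = 1) := by
  rcases exists_mulEquiv_of_two_mul_card_le (two_mul_card_le_of_le_alpha h) with
    ⟨n, ⟨e⟩⟩ | ⟨n, ⟨e⟩⟩ | ⟨n, ⟨e⟩⟩
  · exact .inl ⟨⟨n, ⟨e⟩⟩, (alpha_congr e).trans (alpha_C2pow_prod_S3 n)⟩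
  · exact .inr (.inl ⟨⟨n, ⟨e⟩⟩, (alpha_congr e).trans (alpha_C2pow_prod_D8 n)⟩)
  · exact .inr (.inr ⟨⟨n, ⟨e⟩⟩, (alpha_congr e).trans (alpha_C2pow n)⟩)

section Maxima

lemma forall_mul_comm_congr {G H : Type*} [Group G] [Group H] (e : G ≃* H) :
    (∀ x y : G, x * y = y * x) ↔ ∀ x y : H, x * y = y * x :=
  e.toEquiv.forall₂_congr e.toEquiv fun {x y} => by
    rw [← e.injective.eq_iff, map_mul, map_mul]
    rfl

lemma not_forall_mul_comm_C2pow_prod_D8 (n : ℕ) : ¬ ∀ x y : C2pow n × D8, x * y = y * x :=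
  fun hcomm => (by decide : (.r 1 * .sr 0 : D8) ≠ .sr 0 * .r 1)
    (congrArg Prod.snd (hcomm (1, .r 1) (1, .sr 0)))

lemma isNilpotent_C2pow_prod_D8 (n : ℕ) : Group.IsNilpotent (C2pow n × D8) := by
  have hD8 : IsPGroup 2 D8 := IsPGroup.of_card (n := 3) DihedralGroup.nat_card
  have : Group.IsNilpotent D8 := hD8.isNilpotent
  infer_instance

lemma not_isNilpotent_C2pow_prod_S3 (n : ℕ) : ¬ Group.IsNilpotent (C2pow n × S3) := by
  intro _
  have : Group.IsNilpotent S3 :=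
    Group.nilpotent_of_surjective (MonoidHom.snd (C2pow n) S3) Prod.snd_surjective
  have hcenter : Subgroup.center S3 = ⊥ := (Subgroup.eq_bot_iff_forall _).2 fun x hx =>
    (by decide : ∀ x : S3, (∀ y, y * x = x * y) → x = 1) x (Subgroup.mem_center_iff.1 hx)
  exact Group.IsNilpotent.center_ne_bot S3 hcenter

lemma isMaxAlpha_and_maximizers_eq {F : Set FiniteGrp.{u}} {a : ℚ} {K : ℕ → Type}
    [∀ n, Group (K n)] [∀ n, Finite (K n)] (halpha : ∀ n, alpha (K n) = a)
    (hmem : ∀ (G : FiniteGrp.{u}) (n : ℕ), Nonempty (G ≃* K n) → G ∈ F)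
    (hF : ∀ G ∈ F, a ≤ alpha G → ∃ n, Nonempty (G ≃* K n)) :
    IsMaxAlpha F a ∧ maximizers F = {G : FiniteGrp.{u} | ∃ n : ℕ, Nonempty (G ≃* K n)} := by
  have halpha' {G : FiniteGrp.{u}} {n : ℕ} (e : G ≃* K n) : alpha G = a :=
    (alpha_congr e).trans (halpha n)
  have hmax : IsMaxAlpha F a := by
    constructor
    · let G : FiniteGrp.{u} := FiniteGrp.of (ULift.{u} (K 0))
      have e : G ≃* K 0 := MulEquiv.ulift
      exact ⟨G, hmem G 0 ⟨e⟩, halpha' e⟩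
    · rintro _ ⟨G, hG, rfl⟩
      by_contra! hlt
      obtain ⟨n, ⟨e⟩⟩ := hF G hG hlt.le
      exact hlt.ne' (halpha' e)
  refine ⟨hmax, Set.ext fun G => ⟨fun hG => hF G hG.1 (hG.2.unique hmax).ge, ?_⟩⟩
  rintro ⟨n, ⟨e⟩⟩
  exact ⟨hmem G n ⟨e⟩, (halpha' e).symm ▸ hmax⟩

theorem isMaxAlpha_and_maximizers_nonAbelianGroups :
    IsMaxAlpha nonAbelianGroups.{u} (7 / 8) ∧ maximizers nonAbelianGroups.{u} =
      {G : FiniteGrp.{u} | ∃ n : ℕ, Nonempty (G ≃* C2pow n × D8)} := by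
  refine isMaxAlpha_and_maximizers_eq alpha_C2pow_prod_D8
    (fun G n ⟨e⟩ hcomm => not_forall_mul_comm_C2pow_prod_D8 n ((forall_mul_comm_congr e).1 hcomm))
    fun G hG hle => ?_
  rcases classification_of_le_alpha G (le_trans (by norm_num) hle) with
    ⟨-, halpha⟩ | ⟨hD8, -⟩ | ⟨⟨n, ⟨e⟩⟩, -⟩
  · norm_num [halpha] at hle
  · exact hD8
  · exact absurd ((forall_mul_comm_congr e).2 mul_comm) hG

theorem isMaxAlpha_and_maximizers_nonNilpotentGroups :
    IsMaxAlpha nonNilpotentGroups.{u} (5 / 6) ∧ maximizers nonNilpotentGroups.{u} =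
      {G : FiniteGrp.{u} | ∃ n : ℕ, Nonempty (G ≃* C2pow n × S3)} := by
  refine isMaxAlpha_and_maximizers_eq alpha_C2pow_prod_S3
    (fun G n ⟨e⟩ hnil => not_isNilpotent_C2pow_prod_S3 n ((Group.isNilpotent_congr e).1 hnil))
    fun G hG hle => ?_
  rcases classification_of_le_alpha G hle with ⟨hS3, -⟩ | ⟨⟨n, ⟨e⟩⟩, -⟩ | ⟨⟨n, ⟨e⟩⟩, -⟩
  · exact hS3
  · exact absurd ((Group.isNilpotent_congr e).2 (isNilpotent_C2pow_prod_D8 n)) hG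
  · exact absurd ((Group.isNilpotent_congr e).2 inferInstance) hG

end Maxima

theorem mainTheorem5 :
    -- the values of `α` on the groups that occur
    (alpha S3 = 5 / 6 ∧ alpha D8 = 7 / 8 ∧
      ∀ n : ℕ, alpha (C2pow n × S3) = 5 / 6 ∧ alpha (C2pow n × D8) = 7 / 8 ∧
        alpha (C2pow n) = 1) ∧
    -- the classification
    (∀ (G : Type u) [Group G] [Finite G], alpha G ≥ 5 / 6 →
      ((∃ n : ℕ, Nonempty (G ≃* C2pow n × S3)) ∧ alpha G = 5 / 6) ∨
      ((∃ n : ℕ, Nonempty (G ≃* C2pow n × D8)) ∧ alpha G = 7 / 8) ∨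
      ((∃ n : ℕ, Nonempty (G ≃* C2pow n)) ∧ alpha G = 1)) ∧
    -- the maximum over non-abelian groups
    (IsMaxAlpha nonAbelianGroups.{u} (7 / 8) ∧
      maximizers nonAbelianGroups.{u} =
        {G : FiniteGrp.{u} | ∃ n : ℕ, Nonempty (G ≃* C2pow n × D8)}) ∧
    -- the maximum over non-nilpotent groups
    (IsMaxAlpha nonNilpotentGroups.{u} (5 / 6) ∧
      maximizers nonNilpotentGroups.{u} =
        {G : FiniteGrp.{u} | ∃ n : ℕ, Nonempty (G ≃* C2pow n × S3)}) :=
  ⟨⟨alpha_S3, alpha_D8, fun n =>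
      ⟨alpha_C2pow_prod_S3 n, alpha_C2pow_prod_D8 n, alpha_C2pow n⟩⟩,
    classification_of_le_alpha, isMaxAlpha_and_maximizers_nonAbelianGroups,
    isMaxAlpha_and_maximizers_nonNilpotentGroups⟩
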